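/- Work with two qubits, with computational basis $|0\rangle=|00\rangle$, $|1\rangle=|01\rangle$, $|2\rangle=|10\rangle$, $|3\rangle=|11\rangle$ of $\mathbb{C}^4=\mathbb{C}^2\otimes\mathbb{C}^2$. A circuit is a finite sequence of one-qubit unitary gates and $\mathtt{CNOT}$ gates. A generic circuit is a finite sequence of constant gates (one-qubit gates or $\mathtt{CNOT}$s) and placeholders, each on a given qubit and standing for an unspecified one-qubit gate from a prescribed set; filling in all placeholders yields a circuit. A measurement is given by an orthogonal decomposition $\mathbb{C}^4=E_1\oplus\cdots\oplus E_n$; it is a measurement in the orthonormal basis $(b_1,\dots,b_4)$ if each $E_i$ is spanned by some of the vectors $b_k$ (for instance, if the $E_i$ are the four lines $\mathbb{C}b_k$). A circuit simulates $u\in U(4)$ up to this measurement if, up to a global phase, it performs an operator $vu$, where $v\in U(4)$ preserves each $E_i$. **Proposition.** There is a generic circuit containing exactly two $\mathtt{CNOT}$s with the following property: for every $u\in U(4)$ its placeholders can be filled in such that the resulting circuit simulates $u$ up to every measurement in every orthonormal basis of $\mathbb{C}^4$ each of whose vectors lies in $\mathrm{span}(|0\rangle,|3\rangle)$ or in $\mathrm{span}(|1\rangle,|2\rangle)$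 (for instance, any such basis of Bell states). The placeholder values depend only on $u$, not on the basis or the measurement. -/

import Mathlib

namespace TwoQubit

/-- The index `(a, b)` stands for the computational basis state `|a b⟩`, `a` being the value of the
high-order (first, top) qubit and `b` that of the low-order (second, bottom) qubit. -/
abbrev Idx : Type := Fin 2 × Fin 2

/-- The two-qubit state space `ℂ² ⊗ ℂ²`, with its Hermitian inner product. -/
abbrev StateSpace : Type := EuclideanSpace ℂ Idx

/-- The computational basis state `|j⟩`, `j = 2 a + b`, that is, `|0⟩ = |00⟩`, `|1⟩ = |01⟩`,
`|2⟩ = |10⟩`, `|3⟩ = |11⟩`. -/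
noncomputable def ket (j : Fin 4) : StateSpace :=
  EuclideanSpace.single (![((0, 0) : Idx), (0, 1), (1, 0), (1, 1)] j) 1

/-! ### Circuits -/

/-- The gates: a one-qubit gate acting on qubit `q` (`0` is the high-order qubit, `1` the low-order
one), or a CNOT with the given control qubit (the other qubit is the target). -/
inductive Gate : Type
  | oneQubit (q : Fin 2) (g : Matrix.unitaryGroup (Fin 2) ℂ) : Gate
  | cnot (control : Fin 2) : Gate

/-- The matrix of CNOT in the computational basis. Addition in `Fin 2` is modulo 2, so control `0`
maps `|a, b⟩` to `|a, a ⊕ b⟩`, and control `1` maps `|a, b⟩` to `|a ⊕ b, b⟩`. -/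
def cnotMatrix (control : Fin 2) : Matrix Idx Idx ℂ :=
  Matrix.of fun i j =>
    if i = (if control = 0 then (j.1, j.1 + j.2) else (j.1 + j.2, j.2)) then 1 else 0

/-- The operator on two qubits performed by a gate. -/
def Gate.matrix : Gate → Matrix Idx Idx ℂ
  | .oneQubit q g =>
      if q = 0 then Matrix.kronecker (g : Matrix (Fin 2) (Fin 2) ℂ) (1 : Matrix (Fin 2) (Fin 2) ℂ)
      else Matrix.kronecker (1 : Matrix (Fin 2) (Fin 2) ℂ) (g : Matrix (Fin 2) (Fin 2) ℂ)
  | .cnot control => cnotMatrix control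

/-- A two-qubit circuit: a sequence of gates in the order in which they are applied. -/
abbrev Circuit : Type := List Gate

/-- The operator performed by a circuit (later gates multiply on the left). -/
def Circuit.matrix : Circuit → Matrix Idx Idx ℂ
  | [] => 1
  | g :: C => Circuit.matrix C * g.matrix

/-- An entry of a generic circuit: a constant gate, or a placeholder on qubit `q` for an unspecified
one-qubit gate from the set `allowed`. -/
inductive Slot : Type
  | constant (g : Gate) : Slot
  | placeholder (q : Fin 2) (allowed : Set (Matrix.unitaryGroup (Fin 2) ℂ)) : Slot

/-- The gates which may fill a slot. -/
def Slot.gates : Slot → Set Gate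
  | .constant g => {g}
  | .placeholder q allowed => {h | ∃ g ∈ allowed, h = Gate.oneQubit q g}

/-- A generic (basic) circuit: constant gates are CNOTs or one-qubit gates, and all placeholders are
for one-qubit gates. -/
abbrev GenericCircuit : Type := List Slot

/-- The number of CNOT gates in a generic circuit. -/
def GenericCircuit.cnotCount : GenericCircuit → ℕ
  | [] => 0
  | Slot.constant (Gate.cnot _) :: S => GenericCircuit.cnotCount S + 1
  | _ :: S => GenericCircuit.cnotCount S

/-- `C` is obtained from the generic circuit `S` by specifying values for all placeholders. -/
def IsInstance (C : Circuit) (S : GenericCircuit) : Prop :=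
  List.Forall₂ (fun g s => g ∈ Slot.gates s) C S

/-! ### Measurements -/

/-- A projective measurement with `n` outcomes, given by an orthogonal decomposition
`E₁ ⊕ ⋯ ⊕ Eₙ` of the state space. -/
structure Measurement (n : ℕ) where
  space : Fin n → Submodule ℂ StateSpace
  orthogonal : ∀ i j, i ≠ j → space i ⟂ space j
  complete : ⨆ i, space i = ⊤

/-- `M` is a measurement in the basis `b`: every subspace of the decomposition is spanned by some of
the vectors of `b`. The complete measurement onto the four lines `ℂ b k` is a special case. -/
def Measurement.IsIn {n : ℕ} (M : Measurement n) (b : OrthonormalBasis (Fin 4) ℂ StateSpace) :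
    Prop :=
  ∀ i, ∃ s : Set (Fin 4), M.space i = Submodule.span ℂ (b '' s)

/-- The operator `v` preserves each subspace of the decomposition. -/
def Measurement.PreservedBy {n : ℕ} (M : Measurement n) (v : Matrix Idx Idx ℂ) : Prop :=
  ∀ i, ∀ x ∈ M.space i, Matrix.toEuclideanLin v x ∈ M.space i

/-- The circuit `C` simulates the operator `u` up to the measurement `M`: up to a global phase `z`,
it performs `v u` for some unitary `v` preserving each subspace of the decomposition. -/
def SimulatesUpTo {n : ℕ} (C : Circuit) (u : Matrix.unitaryGroup Idx ℂ) (M : Measurement n) :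
    Prop :=
  ∃ v : Matrix.unitaryGroup Idx ℂ, M.PreservedBy (v : Matrix Idx Idx ℂ) ∧
    ∃ z : ℂ, ‖z‖ = 1 ∧
      Circuit.matrix C = z • ((v : Matrix Idx Idx ℂ) * (u : Matrix Idx Idx ℂ))

/-- Every vector of the basis lies in `span(|0⟩, |3⟩)` or in `span(|1⟩, |2⟩)`. -/
def IsParityBasis (b : OrthonormalBasis (Fin 4) ℂ StateSpace) : Prop :=
  ∀ k, b k ∈ Submodule.span ℂ {ket 0, ket 3} ∨ b k ∈ Submodule.span ℂ {ket 1, ket 2}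

end TwoQubit

namespace TwoQubit

open Matrix
open scoped Kronecker
open Module.End (eigenspace mem_eigenspace_iff)

/-! The freedom left by the measurement is spent on making `u` cheap. `parityPhase p` is scalar on
each parity plane, so it preserves every allowed measurement whatever `p` is; one real parameter is
thus free, and one real condition separates operators with two CNOTs from general ones.

That condition, for `u` scaled to determinant one, is that `u * pairing * uᵀ * pairing` has real
trace. In the magic basis this matrix is similar to `U * Uᵀ`, a symmetric unitary, which is
diagonalized by a real orthogonal `O` (`exists_orthogonal_diagonalization`). Determinant one and
real trace force its eigenvalues into conjugate pairs (`exists_mul_eq_one`), so it has a diagonal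
square root `D` of the form `canonicalDiag s t`, and `U = O * D * R` with `O` and `R` in SO(4)
(`exists_two_cnot_decomposition`). Back in the computational basis, SO(4) becomes the group
`IsSpecialReal`, whose elements are tensor products (`IsSpecialReal.exists_kronecker`), and `D`
becomes two CNOTs around a tensor product (`canonical_eq_two_cnot`).

A suitable `p` exists because the trace depends on `p` only through `p ^ 2` and its conjugate
(`exists_parityPhase_trace_real`). -/

/-! ### Real orthogonal diagonalization of symmetric unitary matrices -/

theorem exists_common_eigenbasis {n : Type*} [Fintype n] [DecidableEq n] {A B : Matrix n n ℝ}
    (hA : A.IsSymm) (hB : B.IsSymm) (hAB : A * B = B * A) :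
    ∃ (b : OrthonormalBasis n ℝ (EuclideanSpace ℝ n)) (α β : n → ℝ),
      ∀ j, toEuclideanLin A (b j) = α j • b j ∧ toEuclideanLin B (b j) = β j • b j := by
  classical
  have hA' : (toEuclideanLin A).IsSymmetric := isSymmetric_toEuclideanLin_iff.2 (by
    rwa [IsHermitian, conjTranspose_eq_transpose_of_trivial])
  have hB' : (toEuclideanLin B).IsSymmetric := isSymmetric_toEuclideanLin_iff.2 (by
    rwa [IsHermitian, conjTranspose_eq_transpose_of_trivial])
  have hc : Commute (toEuclideanLin A) (toEuclideanLin B) := by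
    ext x i
    simp [toEuclideanLin, toLpLin_apply, Matrix.mulVec_mulVec, hAB]
  have hI := LinearMap.IsSymmetric.directSum_isInternal_of_commute hA' hB' hc
  have hO := LinearMap.IsSymmetric.orthogonalFamily_eigenspace_inf_eigenspace hA' hB'
  -- The joint eigenspaces are indexed by all of `ℝ × ℝ`; only the finitely many nonzero ones can
  -- supply a basis.
  have hfin := WellFoundedGT.finite_ne_bot_of_iSupIndep hI.submodule_iSupIndep
  have : Fintype {i : ℝ × ℝ // eigenspace (toEuclideanLin A) i.2 ⊓
      eigenspace (toEuclideanLin B) i.1 ≠ ⊥} := hfin.fintype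
  have hI' := DirectSum.isInternal_ne_bot_iff.2 hI
  have hO' := hO.comp (Subtype.val_injective (p := fun i : ℝ × ℝ =>
    eigenspace (toEuclideanLin A) i.2 ⊓ eigenspace (toEuclideanLin B) i.1 ≠ ⊥))
  have hn : Module.finrank ℝ (EuclideanSpace ℝ n) = Fintype.card n := finrank_euclideanSpace
  let b := hI'.subordinateOrthonormalBasis hn hO'
  let ix := fun j => hI'.subordinateOrthonormalBasisIndex hn (Fintype.equivFin n j) hO'
  refine ⟨b.reindex (Fintype.equivFin n).symm, fun j => (ix j).1.2, fun j => (ix j).1.1,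
    fun j => ?_⟩
  have h := hI'.subordinateOrthonormalBasis_subordinate hn (Fintype.equivFin n j) hO'
  simpa [mem_eigenspace_iff] using! h

/-- For `S = A + iB` symmetric, `Sᴴ = A - iB`, so the imaginary part of `S * Sᴴ = 1` reads `BA =
AB`: the real symmetric matrices `A` and `B` share an orthonormal eigenbasis. -/
theorem exists_orthogonal_diagonalization {n : Type*} [Fintype n] [DecidableEq n]
    {S : Matrix n n ℂ} (hS : S.IsSymm) (hU : S * Sᴴ = 1) :
    ∃ (O : Matrix n n ℂ) (d : n → ℂ), O * Oᴴ = 1 ∧ O * Oᵀ = 1 ∧ S = O * diagonal d * Oᵀ := by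
  have hsym : ∀ i j, S i j = S j i := fun i j => hS.apply j i
  have hA : (S.map Complex.re).IsSymm := by ext i j; simp [hsym i j]
  have hB : (S.map Complex.im).IsSymm := by ext i j; simp [hsym i j]
  have hAB : S.map Complex.re * S.map Complex.im = S.map Complex.im * S.map Complex.re := by
    ext i j
    have h := congrArg Complex.im (congrFun (congrFun hU i) j)
    have h1 : ((1 : Matrix n n ℂ) i j).im = 0 := by rw [one_apply]; split_ifs <;> simp
    rw [h1, mul_apply, Complex.im_sum] at h
    simp only [mul_apply, map_apply]
    rw [← sub_eq_zero, ← Finset.sum_sub_distrib, ← neg_eq_zero, ← Finset.sum_neg_distrib, ← h]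
    refine Finset.sum_congr rfl fun k _ => ?_
    simp [hsym k j]; ring
  obtain ⟨b, α, β, hb⟩ := exists_common_eigenbasis hA hB hAB
  let R : Matrix n n ℝ := of fun i j => b j i
  have hR : Rᵀ * R = 1 := by
    ext i j
    have := (orthonormal_iff_ite.1 b.orthonormal) i j
    simp only [PiLp.inner_apply] at this
    simpa [R, mul_apply, one_apply, mul_comm] using this
  have hR' : R * Rᵀ = 1 := mul_eq_one_comm.1 hR
  let O : Matrix n n ℂ := R.map Complex.ofRealHom
  have hOO : O * Oᵀ = 1 := by
    have := congrArg (fun X : Matrix n n ℝ => X.map Complex.ofRealHom) hR'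
    simpa only [Matrix.map_mul, transpose_map, Matrix.map_one _ (map_zero Complex.ofRealHom)
      (map_one Complex.ofRealHom)] using this
  have hOH : Oᴴ = Oᵀ := by ext i j; simp [O]
  refine ⟨O, fun j => α j + β j * Complex.I, by rw [hOH, hOO], hOO, ?_⟩
  have key : S * O = O * diagonal (fun j => (α j + β j * Complex.I : ℂ)) := by
    ext i j
    have h1 := congrArg (fun x : EuclideanSpace ℝ n => x i) (hb j).1
    have h2 := congrArg (fun x : EuclideanSpace ℝ n => x i) (hb j).2
    simp [toLpLin_apply, mulVec, dotProduct] at h1 h2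
    rw [mul_diagonal, mul_apply]
    apply Complex.ext
    · simp [O, R, h1, mul_comm]
    · simp [O, R, h2, mul_comm]
  rw [← key, Matrix.mul_assoc, hOO, Matrix.mul_one]

/-- For unit complex numbers of product one, the third elementary symmetric function is the
conjugate of the first, so `hs` says that the sum is real. -/
theorem exists_mul_eq_one {a b c d : ℂ} (h : a * b * c * d = 1)
    (hs : a + b + c + d = a * b * c + a * b * d + a * c * d + b * c * d) :
    a * b = 1 ∨ a * c = 1 ∨ a * d = 1 := by
  have : (a * b - 1) * ((a * c - 1) * (a * d - 1)) = 0 := by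
    linear_combination (a ^ 2 + 1) * h + a * hs
  simpa [sub_eq_zero] using this

/-! ### The pairing and its special unitary isometries as tensor products -/

/-- The matrix of the quadratic form `2 (x₀₀ x₁₁ - x₀₁ x₁₀)`, whose isotropic vectors are the
product vectors. -/
def pairing : Matrix Idx Idx ℂ :=
  !![0, -1; 1, 0] ⊗ₖ !![0, -1; 1, 0]

theorem pairing_mul_self : pairing * pairing = 1 := by
  ext ⟨a, b⟩ ⟨c, d⟩
  fin_cases a <;> fin_cases b <;> fin_cases c <;> fin_cases d <;>
    simp [pairing, mul_apply, Fintype.sum_prod_type, one_apply]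

/-- Unitary matrices of determinant one which preserve the pairing. -/
structure IsSpecialReal (k : Matrix Idx Idx ℂ) : Prop where
  unitary : k * kᴴ = 1
  pairing : k * pairing * kᵀ = pairing
  det : k.det = 1

theorem IsSpecialReal.mul {k l : Matrix Idx Idx ℂ} (hk : IsSpecialReal k) (hl : IsSpecialReal l) :
    IsSpecialReal (k * l) where
  unitary := by
    rw [conjTranspose_mul, Matrix.mul_assoc, ← Matrix.mul_assoc l, hl.unitary, Matrix.one_mul,
      hk.unitary]
  pairing := by
    rw [transpose_mul, show k * l * TwoQubit.pairing * (lᵀ * kᵀ) =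
      k * (l * TwoQubit.pairing * lᵀ) * kᵀ by simp only [Matrix.mul_assoc], hl.pairing, hk.pairing]
  det := by rw [det_mul, hk.det, hl.det, one_mul]

theorem isSpecialReal_kronecker {A B : Matrix (Fin 2) (Fin 2) ℂ} (hA : A * Aᴴ = 1)
    (hB : B * Bᴴ = 1) (hA' : A.det = 1) (hB' : B.det = 1) : IsSpecialReal (A ⊗ₖ B) where
  unitary := by
    rw [conjTranspose_kronecker, ← mul_kronecker_mul, hA, hB, one_kronecker_one]
  pairing := by
    have key : ∀ C : Matrix (Fin 2) (Fin 2) ℂ, C.det = 1 →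
        C * !![0, -1; 1, 0] * Cᵀ = !![0, -1; 1, 0] := by
      intro C hC
      rw [det_fin_two] at hC
      ext i j
      fin_cases i <;> fin_cases j <;> simp [mul_apply, Fin.sum_univ_two]
      · ring
      · linear_combination -hC
      · linear_combination hC
      · ring
    have ht : (A ⊗ₖ B)ᵀ = Aᵀ ⊗ₖ Bᵀ := by ext; simp
    rw [ht, TwoQubit.pairing, ← mul_kronecker_mul, ← mul_kronecker_mul, key A hA', key B hB']
  det := by simp [det_kronecker, hA', hB']

/-- Normalization of a vector of `ℂ²` that also covers the zero vector. -/
theorem exists_unit_multiple (x y : ℂ) : ∃ (r : ℝ) (c d : ℂ),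
    c * star c + d * star d = 1 ∧ x = r * c ∧ y = r * d := by
  by_cases h : Complex.normSq x + Complex.normSq y = 0
  · have hx : x = 0 := Complex.normSq_eq_zero.1 (by
      linarith [Complex.normSq_nonneg x, Complex.normSq_nonneg y])
    have hy : y = 0 := Complex.normSq_eq_zero.1 (by
      linarith [Complex.normSq_nonneg x, Complex.normSq_nonneg y])
    exact ⟨0, 1, 0, by simp, by simp [hx], by simp [hy]⟩
  · have hr : √(Complex.normSq x + Complex.normSq y) ^ 2 =
        Complex.normSq x + Complex.normSq y :=
      Real.sq_sqrt (add_nonneg (Complex.normSq_nonneg _) (Complex.normSq_nonneg _))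
    generalize √(Complex.normSq x + Complex.normSq y) = r at hr
    have hr0 : (r : ℂ) ≠ 0 := by
      rintro h0
      rw [Complex.ofReal_eq_zero] at h0
      exact h (by rw [← hr, h0]; norm_num)
    have hr' : (r : ℂ) ^ 2 = x * star x + y * star y := by
      rw [Complex.star_def, Complex.mul_conj, Complex.mul_conj]
      exact_mod_cast hr
    refine ⟨r, x / r, y / r, ?_, by field_simp, by field_simp⟩
    rw [star_div₀, star_div₀, show star (r : ℂ) = r from Complex.conj_ofReal r]
    field_simp
    exact hr'.symm

/-- The 2×2 matrix with rows `(x, y)` and `(z, w)` is singular, so both rows are multiples of one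
unit vector `(c, d)`. -/
theorem exists_product_of_isotropic {x y z w : ℂ} (h : x * w = y * z)
    (hn : x * star x + y * star y + z * star z + w * star w = 1) :
    ∃ a b c d : ℂ, a * star a + b * star b = 1 ∧ c * star c + d * star d = 1 ∧
      x = a * c ∧ y = a * d ∧ z = b * c ∧ w = b * d := by
  obtain ⟨r, c, d, hcd, hx, hy⟩ := exists_unit_multiple x y
  by_cases hr : (r : ℂ) = 0
  · refine ⟨0, 1, z, w, by simp, ?_, by simp [hx, hr], by simp [hy, hr], by simp, by simp⟩
    simpa [hx, hy, hr] using hn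
  · have hdet : c * w = d * z := by
      apply mul_left_cancel₀ hr
      rw [hx, hy] at h
      linear_combination h
    have hz : z = (z * star c + w * star d) * c := by
      linear_combination -z * hcd - star d * hdet
    have hw : w = (z * star c + w * star d) * d := by
      linear_combination -w * hcd + star c * hdet
    generalize z * star c + w * star d = b at hz hw
    subst hx hy hz hw
    refine ⟨r, b, c, d, ?_, hcd, rfl, rfl, rfl, rfl⟩
    simp only [star_mul] at hn
    linear_combination hn - (r * star (r : ℂ) + b * star b) * hcd

/-- The special unitary matrix with first column `(a, b)`. -/
def specialUnitary (a b : ℂ) : Matrix (Fin 2) (Fin 2) ℂ := !![a, -star b; b, star a]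

theorem specialUnitary_det {a b : ℂ} (h : a * star a + b * star b = 1) :
    (specialUnitary a b).det = 1 := by
  rw [specialUnitary, det_fin_two_of]; linear_combination h

theorem specialUnitary_mul {a b : ℂ} (h : a * star a + b * star b = 1) :
    specialUnitary a b * (specialUnitary a b)ᴴ = 1 := by
  rw [Complex.star_def] at h
  ext i j
  fin_cases i <;> fin_cases j <;> simp [specialUnitary, mul_apply, Fin.sum_univ_two]
  · linear_combination h
  · ring
  · ring
  · linear_combination h

theorem IsSpecialReal.pairing' {k : Matrix Idx Idx ℂ} (hk : IsSpecialReal k) :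
    kᵀ * TwoQubit.pairing * k = TwoQubit.pairing := by
  have h : k * (TwoQubit.pairing * kᵀ * TwoQubit.pairing) = 1 := by
    rw [← Matrix.mul_assoc, ← Matrix.mul_assoc, hk.pairing, pairing_mul_self]
  have h' := congrArg (TwoQubit.pairing * ·) (mul_eq_one_comm.1 h)
  simpa only [← Matrix.mul_assoc, pairing_mul_self, Matrix.one_mul, Matrix.mul_one] using h'

theorem exists_unit_sqrt {x : ℂ} (hx : star x * x = 1) : ∃ s : ℂ, s ^ 2 = x ∧ star s * s = 1 := by
  obtain ⟨s, rfl⟩ := IsAlgClosed.exists_pow_nat_eq x two_pos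
  refine ⟨s, rfl, ?_⟩
  simp only [Complex.star_def, map_pow, ← mul_pow, Complex.conj_mul'] at hx ⊢
  norm_cast at hx ⊢
  exact (pow_eq_one_iff_of_nonneg (by positivity) two_ne_zero).1 hx

/-- Unitarity and the pairing, which couples `|0⟩` with `|3⟩`, reduce `k` to a block on `span(|1⟩,
|2⟩)`. The columns of this block are isotropic, so it is diagonal or antidiagonal. -/
theorem IsSpecialReal.exists_kronecker_of_col {k : Matrix Idx Idx ℂ} (hk : IsSpecialReal k)
    (h0 : ∀ i, k i (0, 0) = if i = (0, 0) then 1 else 0) :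
    ∃ A B : Matrix (Fin 2) (Fin 2) ℂ, A * Aᴴ = 1 ∧ B * Bᴴ = 1 ∧ k = A ⊗ₖ B := by
  have hU : kᴴ * k = 1 := mul_eq_one_comm.1 hk.unitary
  have hr0 : ∀ j, k (0, 0) j = if j = (0, 0) then 1 else 0 := by
    intro j
    have := congrFun (congrFun hU (0, 0)) j
    simpa [mul_apply, Fintype.sum_prod_type, h0, one_apply, eq_comm] using this
  have hr1 : ∀ j, k (1, 1) j = if j = (1, 1) then 1 else 0 := by
    intro j
    have := congrFun (congrFun hk.pairing' (0, 0)) j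
    simp [mul_apply, Fintype.sum_prod_type, h0, TwoQubit.pairing] at this
    rw [this]
    rcases j with ⟨a, b⟩
    fin_cases a <;> fin_cases b <;> simp
  have h1 : ∀ i, k i (1, 1) = if i = (1, 1) then 1 else 0 := by
    intro i
    have := congrFun (congrFun hk.pairing (0, 0)) i
    simp [mul_apply, Fintype.sum_prod_type, hr0, TwoQubit.pairing] at this
    rw [this]
    rcases i with ⟨a, b⟩
    fin_cases a <;> fin_cases b <;> simp
  have hx := congrFun (congrFun hk.pairing' (0, 1)) (0, 1)
  have hy := congrFun (congrFun hk.pairing' (1, 0)) (1, 0)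
  have hv := congrFun (congrFun hk.pairing' (0, 1)) (1, 0)
  have hu := congrFun (congrFun hU (0, 1)) (0, 1)
  -- The determinant excludes the antidiagonal case, in which the two qubits would be swapped.
  have hd : k (0, 1) (0, 1) * k (1, 0) (1, 0) - k (0, 1) (1, 0) * k (1, 0) (0, 1) = 1 := by
    have hm : reindex finProdFinEquiv finProdFinEquiv k = !![1, 0, 0, 0;
        0, k (0, 1) (0, 1), k (0, 1) (1, 0), 0; 0, k (1, 0) (0, 1), k (1, 0) (1, 0), 0;
        0, 0, 0, 1] := by
      have e0 : finProdFinEquiv.symm (0 : Fin (2 * 2)) = (0, 0) := by decide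
      have e1 : finProdFinEquiv.symm (1 : Fin (2 * 2)) = (0, 1) := by decide
      have e2 : finProdFinEquiv.symm (2 : Fin (2 * 2)) = (1, 0) := by decide
      have e3 : finProdFinEquiv.symm (3 : Fin (2 * 2)) = (1, 1) := by decide
      have key : ∀ i j : Fin (2 * 2), reindex finProdFinEquiv finProdFinEquiv k i j =
        k (finProdFinEquiv.symm i) (finProdFinEquiv.symm j) := fun _ _ => rfl
      ext i j
      rw [key]
      change Fin 4 at i j
      fin_cases i <;> fin_cases j <;> simp only [Fin.zero_eta, Fin.mk_one, Fin.reduceFinMk] <;>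
        simp only [e0, e1, e2, e3, h0, h1, hr0, hr1] <;> simp
    have := hk.det
    rw [← det_reindex_self finProdFinEquiv, hm] at this
    simp [det_succ_row_zero, Fin.sum_univ_succ, Fin.succAbove] at this
    linear_combination this
  simp [mul_apply, Fintype.sum_prod_type, hr0, hr1, TwoQubit.pairing] at hx hy hv hu
  generalize hx' : k (0, 1) (0, 1) = x at *
  generalize hz' : k (1, 0) (0, 1) = z at *
  generalize hy' : k (0, 1) (1, 0) = y at *
  generalize hw' : k (1, 0) (1, 0) = w at *
  have hxz : x * z = 0 := by linear_combination (-1 / 2) * hx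
  have hyw : y * w = 0 := by linear_combination (-1 / 2) * hy
  have hxw : x * w = 1 := by linear_combination (1 / 2) * hd - (1 / 2) * hv
  have hz : z = 0 := by linear_combination w * hxz - z * hxw
  have hy0 : y = 0 := by linear_combination x * hyw - y * hxw
  subst hz hy0
  have hxx : star x * x = 1 := by simpa using hu
  have hwx : w = star x := by linear_combination star x * hxw - w * hxx
  obtain ⟨s, rfl, hs⟩ := exists_unit_sqrt hxx
  refine ⟨!![s, 0; 0, star s], !![star s, 0; 0, s], ?_, ?_, ?_⟩
  · ext i j
    fin_cases i <;> fin_cases j <;> simp [mul_apply, Fin.sum_univ_two] <;> simpa [mul_comm] using hs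
  · ext i j
    fin_cases i <;> fin_cases j <;> simp [mul_apply, Fin.sum_univ_two] <;> simpa [mul_comm] using hs
  · simp only [Complex.star_def] at hs hwx
    ext ⟨a, b⟩ ⟨c, d⟩
    fin_cases a <;> fin_cases b <;> fin_cases c <;> fin_cases d <;>
      simp [h0, h1, hr0, hr1, hx', hy', hz', hw', hwx] <;>
      first | linear_combination -hs | ring

/-- The first column of `k` is isotropic, hence a product vector. Some tensor product of special
unitaries has the same first column, and dividing by it leaves the case of first column `|0⟩`. -/
theorem IsSpecialReal.exists_kronecker {k : Matrix Idx Idx ℂ} (hk : IsSpecialReal k) :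
    ∃ A B : Matrix (Fin 2) (Fin 2) ℂ, A * Aᴴ = 1 ∧ B * Bᴴ = 1 ∧ k = A ⊗ₖ B := by
  have hU : kᴴ * k = 1 := mul_eq_one_comm.1 hk.unitary
  have h0 := congrFun (congrFun hk.pairing' (0, 0)) (0, 0)
  have hn := congrFun (congrFun hU (0, 0)) (0, 0)
  simp [mul_apply, Fintype.sum_prod_type, TwoQubit.pairing] at h0 hn
  obtain ⟨a, b, c, d, hab, hcd, h00, h01, h10, h11⟩ := exists_product_of_isotropic
    (x := k (0, 0) (0, 0)) (y := k (0, 1) (0, 0)) (z := k (1, 0) (0, 0)) (w := k (1, 1) (0, 0))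
    (by linear_combination (1 / 2) * h0)
    (by simp only [Complex.star_def]; linear_combination hn)
  have hA := specialUnitary_mul hab
  have hB := specialUnitary_mul hcd
  have hA' := specialUnitary_det hab
  have hB' := specialUnitary_det hcd
  have hcol : ∀ i, k i (0, 0) = (specialUnitary a b ⊗ₖ specialUnitary c d) i (0, 0) := by
    rintro ⟨i, j⟩
    fin_cases i <;> fin_cases j <;> simp [specialUnitary, h00, h01, h10, h11]
  generalize specialUnitary a b = A at *
  generalize specialUnitary c d = B at *
  have hL := isSpecialReal_kronecker hA hB hA' hB'
  have hL' : IsSpecialReal (Aᴴ ⊗ₖ Bᴴ) := isSpecialReal_kronecker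
    (by simpa using mul_eq_one_comm.1 hA) (by simpa using mul_eq_one_comm.1 hB)
    (by simp [det_conjTranspose, hA']) (by simp [det_conjTranspose, hB'])
  have hLL : (Aᴴ ⊗ₖ Bᴴ) * (A ⊗ₖ B) = 1 := by
    rw [← mul_kronecker_mul, mul_eq_one_comm.1 hA, mul_eq_one_comm.1 hB, one_kronecker_one]
  obtain ⟨A', B', hA1, hB1, hk'⟩ := (hL'.mul hk).exists_kronecker_of_col (by
    intro i
    rw [← one_apply, ← hLL]
    simp only [mul_apply, hcol])
  refine ⟨A * A', B * B', ?_, ?_, ?_⟩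
  · rw [conjTranspose_mul, Matrix.mul_assoc, ← Matrix.mul_assoc A', hA1, Matrix.one_mul, hA]
  · rw [conjTranspose_mul, Matrix.mul_assoc, ← Matrix.mul_assoc B', hB1, Matrix.one_mul, hB]
  · rw [mul_kronecker_mul, ← hk', ← Matrix.mul_assoc, mul_eq_one_comm.1 hLL, Matrix.one_mul]

/-! ### Pairing the eigenvalues when the trace is real -/

theorem exists_ordered_diagonalization {S : Matrix Idx Idx ℂ} (hS : S.IsSymm) (hU : S * Sᴴ = 1)
    (hdet : S.det = 1) (htr : star S.trace = S.trace) :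
    ∃ (O : Matrix Idx Idx ℂ) (d : Idx → ℂ), O * Oᴴ = 1 ∧ O * Oᵀ = 1 ∧ O.det = 1 ∧
      S = O * diagonal d * Oᵀ ∧ (∀ i, star (d i) * d i = 1) ∧
      d (1, 1) = star (d (0, 0)) ∧ d (1, 0) = star (d (0, 1)) := by
  obtain ⟨O, d, hO, hO', hSd⟩ := exists_orthogonal_diagonalization hS hU
  have hOT : Oᴴ = Oᵀ := by
    rw [← Matrix.one_mul Oᴴ, ← mul_eq_one_comm.1 hO', Matrix.mul_assoc, hO, Matrix.mul_one]
  have hD : diagonal d = Oᵀ * S * O := by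
    have h := mul_eq_one_comm.1 hO'
    rw [hSd, show Oᵀ * (O * diagonal d * Oᵀ) * O = (Oᵀ * O) * diagonal d * (Oᵀ * O) by
      simp only [Matrix.mul_assoc], h, Matrix.one_mul, Matrix.mul_one]
  have hunit : ∀ i, star (d i) * d i = 1 := by
    have h : diagonal d * (diagonal d)ᴴ = 1 := by
      conv_lhs => rw [hD]
      rw [conjTranspose_mul, conjTranspose_mul, ← hOT, conjTranspose_conjTranspose,
        show Oᴴ * S * O * (Oᴴ * (Sᴴ * O)) = Oᴴ * (S * (O * Oᴴ) * Sᴴ) * O by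
          simp only [Matrix.mul_assoc], hO, Matrix.mul_one, hU, Matrix.mul_one,
        mul_eq_one_comm.1 hO]
    intro i
    have := congrFun (congrFun h i) i
    simpa [diagonal_conjTranspose, mul_comm] using this
  have hdet2 : O.det * O.det = 1 := by
    have := congrArg det hO'
    simpa using this
  have hprod : d (0, 0) * d (1, 1) * d (0, 1) * d (1, 0) = 1 := by
    have := hdet
    rw [hSd, det_mul, det_mul, det_transpose, det_diagonal, Fintype.prod_prod_type] at this
    simp at this
    linear_combination this - (d (0, 0) * d (1, 1) * d (0, 1) * d (1, 0)) * hdet2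
  have hsum : star (d (0, 0) + d (1, 1) + d (0, 1) + d (1, 0)) =
      d (0, 0) + d (1, 1) + d (0, 1) + d (1, 0) := by
    have : S.trace = d (0, 0) + d (1, 1) + d (0, 1) + d (1, 0) := by
      rw [hSd, Matrix.mul_assoc, trace_mul_comm, Matrix.mul_assoc, mul_eq_one_comm.1 hO',
        Matrix.mul_one, trace_diagonal, Fintype.sum_prod_type]
      simp; ring
    rw [← this, htr]
  have hperm : ∃ σ : Equiv.Perm Idx, d (σ (0, 0)) * d (σ (1, 1)) = 1 ∧
      d (σ (0, 1)) * d (σ (1, 0)) = 1 := by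
    have hs : ∀ {a b c e : ℂ}, star a * a = 1 → a * b * c * e = 1 → star a = b * c * e := by
      intro a b c e h1 h2
      linear_combination b * c * e * h1 - star a * h2
    rw [star_add, star_add, star_add, hs (hunit (0, 0)) hprod,
      hs (b := d (0, 0)) (c := d (0, 1)) (e := d (1, 0)) (hunit (1, 1)) (by rw [← hprod]; ring),
      hs (b := d (0, 0)) (c := d (1, 1)) (e := d (1, 0)) (hunit (0, 1)) (by rw [← hprod]; ring),
      hs (b := d (0, 0)) (c := d (1, 1)) (e := d (0, 1)) (hunit (1, 0)) (by rw [← hprod]; ring)]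
      at hsum
    rcases exists_mul_eq_one hprod (by rw [← hsum]; ring) with h | h | h
    · refine ⟨1, h, ?_⟩
      simp only [Equiv.Perm.coe_one, id]
      linear_combination hprod - d (0, 1) * d (1, 0) * h
    · refine ⟨Equiv.swap (1, 1) (0, 1), ?_⟩
      rw [Equiv.swap_apply_of_ne_of_ne (by decide) (by decide), Equiv.swap_apply_left,
        Equiv.swap_apply_right, Equiv.swap_apply_of_ne_of_ne (by decide) (by decide)]
      exact ⟨h, by linear_combination hprod - d (1, 1) * d (1, 0) * h⟩
    · refine ⟨Equiv.swap (1, 1) (1, 0), ?_⟩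
      rw [Equiv.swap_apply_of_ne_of_ne (by decide) (by decide), Equiv.swap_apply_left,
        Equiv.swap_apply_right, Equiv.swap_apply_of_ne_of_ne (by decide) (by decide)]
      exact ⟨h, by linear_combination hprod - d (1, 1) * d (0, 1) * h⟩
  obtain ⟨σ, h1, h2⟩ := hperm
  let P : Matrix Idx Idx ℂ := O.submatrix id σ
  have hP : P * Pᴴ = 1 := by
    simp only [P, conjTranspose_submatrix]
    rw [submatrix_mul_equiv, hO, submatrix_id_id]
  have hP' : P * Pᵀ = 1 := by
    simp only [P, transpose_submatrix]
    rw [submatrix_mul_equiv, hO', submatrix_id_id]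
  have hSP : S = P * diagonal (d ∘ σ) * Pᵀ := by
    simp only [P, transpose_submatrix, ← submatrix_diagonal_equiv]
    rw [submatrix_mul_equiv, submatrix_mul_equiv, ← hSd, submatrix_id_id]
  have hPdet : P.det * P.det = 1 := by
    have := congrArg det hP'
    simpa using this
  have hinv : ∀ {a b : ℂ}, star a * a = 1 → a * b = 1 → b = star a := by
    intro a b ha hb
    linear_combination star a * hb - b * ha
  -- `P.det` is a sign; multiplying one column by it makes the determinant `P.det ^ 2 = 1` and
  -- leaves the diagonalization intact.
  let e : Idx → ℂ := fun i => if i = (0, 0) then P.det else 1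
  have he : ∀ i, e i * e i = 1 := by
    intro i
    simp only [e]
    split_ifs <;> simp [hPdet]
  have hereal : ∀ i, star (e i) = e i := by
    intro i
    rcases mul_self_eq_one_iff.1 (he i) with h | h <;> simp [h]
  have hee : diagonal e * diagonal e = 1 := by
    rw [diagonal_mul_diagonal, ← diagonal_one]
    congr 1; funext i; exact he i
  refine ⟨P * diagonal e, d ∘ σ, ?_, ?_, ?_, ?_, fun i => hunit _, hinv (hunit _) h1,
    hinv (hunit _) h2⟩
  · rw [conjTranspose_mul, diagonal_conjTranspose, show star e = e from funext hereal,
      Matrix.mul_assoc, ← Matrix.mul_assoc (diagonal e), hee, Matrix.one_mul, hP]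
  · rw [transpose_mul, diagonal_transpose,
      Matrix.mul_assoc, ← Matrix.mul_assoc (diagonal e), hee, Matrix.one_mul, hP']
  · rw [det_mul, det_diagonal, Fintype.prod_prod_type]
    simpa [e] using hPdet
  · have : diagonal e * diagonal (d ∘ σ) * diagonal e = diagonal (d ∘ σ) := by
      rw [diagonal_mul_diagonal, diagonal_mul_diagonal]
      congr 1; funext i
      linear_combination (d ∘ σ) i * he i
    rw [transpose_mul, diagonal_transpose,
      show P * diagonal e * diagonal (d ∘ σ) * (diagonal e * Pᵀ) =
        P * (diagonal e * diagonal (d ∘ σ) * diagonal e) * Pᵀ by simp only [Matrix.mul_assoc],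
      this, hSP]

/-! ### The magic basis and the two-CNOT decomposition -/

noncomputable def invSqrtTwo : ℂ := ((√2)⁻¹ : ℝ)

theorem invSqrtTwo_mul_self : invSqrtTwo * invSqrtTwo = 1 / 2 := by
  rw [invSqrtTwo, ← Complex.ofReal_mul, ← mul_inv, Real.mul_self_sqrt (by norm_num)]
  norm_num

theorem conj_invSqrtTwo : (starRingEnd ℂ) invSqrtTwo = invSqrtTwo := Complex.conj_ofReal _

/-- The magic basis: its columns are Bell states with suitable phases. -/
noncomputable def magic : Matrix Idx Idx ℂ :=
  of fun i j =>
    ![![![![1, Complex.I], ![0, 0]], ![![0, 0], ![Complex.I, 1]]],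
      ![![![0, 0], ![Complex.I, -1]], ![![1, -Complex.I], ![0, 0]]]] i.1 i.2 j.1 j.2 * invSqrtTwo

theorem magic_mul_conjTranspose : magic * magicᴴ = 1 := by
  ext ⟨a, b⟩ ⟨c, d⟩
  fin_cases a <;> fin_cases b <;> fin_cases c <;> fin_cases d <;>
    simp [magic, mul_apply, Fintype.sum_prod_type, conj_invSqrtTwo] <;> ring_nf <;>
    simp [pow_two, invSqrtTwo_mul_self] <;> norm_num [invSqrtTwo_mul_self]

theorem magic_mul_transpose : magic * magicᵀ = pairing := by
  ext ⟨a, b⟩ ⟨c, d⟩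
  fin_cases a <;> fin_cases b <;> fin_cases c <;> fin_cases d <;>
    simp [magic, mul_apply, Fintype.sum_prod_type, pairing] <;> ring_nf <;>
    simp [pow_two, invSqrtTwo_mul_self] <;> norm_num [invSqrtTwo_mul_self]

theorem isSpecialReal_magic_conj {O : Matrix Idx Idx ℂ} (h1 : O * Oᴴ = 1) (h2 : O * Oᵀ = 1)
    (h3 : O.det = 1) : IsSpecialReal (magic * O * magicᴴ) where
  unitary := by
    rw [conjTranspose_mul, conjTranspose_mul, conjTranspose_conjTranspose,
      show magic * O * magicᴴ * (magic * (Oᴴ * magicᴴ)) =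
        magic * (O * (magicᴴ * magic) * Oᴴ) * magicᴴ by simp only [Matrix.mul_assoc],
      mul_eq_one_comm.1 magic_mul_conjTranspose, Matrix.mul_one, h1, Matrix.mul_one,
      magic_mul_conjTranspose]
  pairing := by
    have hT : magicᵀ * magicᴴᵀ = 1 := by
      rw [← transpose_mul, mul_eq_one_comm.1 magic_mul_conjTranspose, transpose_one]
    rw [transpose_mul, transpose_mul, ← magic_mul_transpose,
      show magic * O * magicᴴ * (magic * magicᵀ) * (magicᴴᵀ * (Oᵀ * magicᵀ)) =
        magic * (O * (magicᴴ * magic) * (magicᵀ * magicᴴᵀ) * Oᵀ) * magicᵀ by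
          simp only [Matrix.mul_assoc],
      mul_eq_one_comm.1 magic_mul_conjTranspose, hT, Matrix.mul_one, Matrix.mul_one, h2,
      Matrix.mul_one]
  det := by
    have := congrArg det magic_mul_conjTranspose
    rw [det_mul, det_one] at this
    rw [det_mul, det_mul, h3, mul_one, this]

/-- The spectrum of the canonical two-CNOT operators in the magic basis. -/
noncomputable def canonicalDiag (s t : ℂ) : Idx → ℂ :=
  fun i => ![![s ^ 2, t ^ 2], ![star t ^ 2, star s ^ 2]] i.1 i.2

/-- Conjugation by the CNOT turns `X ⊗ 1` into `X ⊗ X` and `1 ⊗ Z` into `Z ⊗ Z`, which the magic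
basis diagonalizes simultaneously. Writing `s ^ 2 = exp(iα)` and `t ^ 2 = exp(iβ)`, the gate `g` is
`exp(i(α-β)X/2)` and `h` is `exp(i(α+β)Z/2)`; the half angles are why the spectrum is given by
squares. -/
theorem canonical_eq_two_cnot {s t : ℂ} (hs : star s * s = 1) (ht : star t * t = 1) :
    ∃ g h : Matrix (Fin 2) (Fin 2) ℂ, g * gᴴ = 1 ∧ h * hᴴ = 1 ∧
      magic * diagonal (canonicalDiag s t) * magicᴴ = cnotMatrix 0 * (g ⊗ₖ h) * cnotMatrix 0 := by
  let x := (s * star t + star s * t) / 2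
  let y := (s * star t - star s * t) / 2
  simp only [Complex.star_def] at hs ht
  refine ⟨!![x, y; y, x], !![s * t, 0; 0, star s * star t], ?_, ?_, ?_⟩
  · ext i j
    fin_cases i <;> fin_cases j <;> simp [mul_apply, x, y, Complex.conj_ofNat]
    · linear_combination hs * (starRingEnd ℂ t * t) + ht
    · ring
    · ring
    · linear_combination hs * (starRingEnd ℂ t * t) + ht
  · ext i j
    fin_cases i <;> fin_cases j <;> simp [mul_apply]
    · linear_combination hs * (starRingEnd ℂ t * t) + ht
    · linear_combination hs * (starRingEnd ℂ t * t) + ht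
  · ext ⟨a, b⟩ ⟨c, d⟩
    have hI := Complex.I_mul_I
    have hr := invSqrtTwo_mul_self
    fin_cases a <;> fin_cases b <;> fin_cases c <;> fin_cases d <;>
      simp [magic, mul_apply, Fintype.sum_prod_type, conj_invSqrtTwo, canonicalDiag, cnotMatrix,
        diagonal_apply, x, y]
    all_goals
      generalize starRingEnd ℂ s = s' at *
      generalize starRingEnd ℂ t = t' at *
      generalize invSqrtTwo = r at *
      first
      | linear_combination s ^ 2 * hr - t ^ 2 * r ^ 2 * hI + t ^ 2 * hr - s ^ 2 / 2 * ht -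
          t ^ 2 / 2 * hs
      | linear_combination s ^ 2 * hr + t ^ 2 * r ^ 2 * hI - t ^ 2 * hr - s ^ 2 / 2 * ht +
          t ^ 2 / 2 * hs
      | linear_combination t' ^ 2 * hr - t' ^ 2 * r ^ 2 * hI + s' ^ 2 * hr - t' ^ 2 / 2 * hs -
          s' ^ 2 / 2 * ht
      | linear_combination t' ^ 2 * hr - t' ^ 2 * r ^ 2 * hI - s' ^ 2 * hr - t' ^ 2 / 2 * hs +
          s' ^ 2 / 2 * ht

theorem exists_two_cnot_decomposition {u : Matrix Idx Idx ℂ} (hu : u * uᴴ = 1) (hdet : u.det = 1)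
    (htr : star (u * pairing * uᵀ * pairing).trace = (u * pairing * uᵀ * pairing).trace) :
    ∃ k l : Matrix Idx Idx ℂ, IsSpecialReal k ∧ IsSpecialReal l ∧
      ∃ s t : ℂ, star s * s = 1 ∧ star t * t = 1 ∧
        u = k * (magic * diagonal (canonicalDiag s t) * magicᴴ) * l := by
  have hE := magic_mul_conjTranspose
  have hE' := mul_eq_one_comm.1 hE
  let U := magicᴴ * u * magic
  have hU : U * Uᴴ = 1 := by
    simp only [U, conjTranspose_mul, conjTranspose_conjTranspose]
    rw [show magicᴴ * u * magic * (magicᴴ * (uᴴ * magic)) =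
      magicᴴ * (u * (magic * magicᴴ) * uᴴ) * magic by simp only [Matrix.mul_assoc], hE,
      Matrix.mul_one, hu, Matrix.mul_one, hE']
  have huU : u = magic * U * magicᴴ := by
    simp only [U]
    rw [show magic * (magicᴴ * u * magic) * magicᴴ = (magic * magicᴴ) * u * (magic * magicᴴ) by
      simp only [Matrix.mul_assoc], hE, Matrix.one_mul, Matrix.mul_one]
  have hUdet : U.det = 1 := by
    have := congrArg det hE'
    rw [det_mul, det_one] at this
    simp only [U]
    rw [det_mul, det_mul, hdet, mul_one, this]
  have hUT : Uᵀ * Uᵀᴴ = 1 := by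
    have := congrArg transpose (mul_eq_one_comm.1 hU)
    rw [transpose_mul, transpose_one] at this
    exact this
  have hEc : magicᴴᵀ * magicᴴ = pairing := by
    have := congrArg conjTranspose magic_mul_transpose
    rw [conjTranspose_mul] at this
    have hp : pairingᴴ = pairing := by
      ext ⟨a, b⟩ ⟨c, d⟩
      fin_cases a <;> fin_cases b <;> fin_cases c <;> fin_cases d <;> simp [pairing]
    rw [hp] at this
    exact this
  obtain ⟨O, d, hO, hO', hOdet, hS, hd, hd1, hd2⟩ := exists_ordered_diagonalization
    (S := U * Uᵀ) (by rw [IsSymm, transpose_mul, transpose_transpose])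
    (by rw [conjTranspose_mul, show U * Uᵀ * (Uᵀᴴ * Uᴴ) = U * (Uᵀ * Uᵀᴴ) * Uᴴ by
      simp only [Matrix.mul_assoc], hUT, Matrix.mul_one, hU])
    (by rw [det_mul, det_transpose, hUdet, mul_one])
    (by
      have : (U * Uᵀ).trace = (u * pairing * uᵀ * pairing).trace := by
        simp only [U, transpose_mul]
        rw [show magicᴴ * u * magic * (magicᵀ * (uᵀ * magicᴴᵀ)) =
          magicᴴ * (u * (magic * magicᵀ) * uᵀ * magicᴴᵀ) by simp only [Matrix.mul_assoc],
          trace_mul_comm, magic_mul_transpose, Matrix.mul_assoc _ magicᴴᵀ, hEc]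
      rw [this, htr])
  -- Fourth roots are needed: `D` is a square root of `diagonal d`, and its entries are themselves
  -- squares.
  obtain ⟨s', hs', hs'1⟩ := exists_unit_sqrt (hd (0, 0))
  obtain ⟨s, hs, hs1⟩ := exists_unit_sqrt hs'1
  obtain ⟨t', ht', ht'1⟩ := exists_unit_sqrt (hd (0, 1))
  obtain ⟨t, ht, ht1⟩ := exists_unit_sqrt ht'1
  let D := diagonal (canonicalDiag s t)
  have hDD : D * D = diagonal d := by
    simp only [D, diagonal_mul_diagonal]
    congr 1
    funext ⟨a, b⟩
    fin_cases a <;> fin_cases b <;>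
      simp [canonicalDiag, hd1, hd2, ← hs', ← ht', ← hs, ← ht] <;> ring
  have hDu : D * Dᴴ = 1 := by
    simp only [D, diagonal_conjTranspose, diagonal_mul_diagonal]
    rw [← diagonal_one]
    congr 1
    simp only [Complex.star_def] at hs1 ht1
    funext ⟨a, b⟩
    fin_cases a <;> fin_cases b <;> 
      simp [canonicalDiag, ← mul_pow, mul_comm _ ((starRingEnd ℂ) _), hs1, ht1]
  have hDu' := mul_eq_one_comm.1 hDu
  have hDdet : D.det = 1 := by
    simp only [D, det_diagonal, Fintype.prod_prod_type]
    simp only [Complex.star_def] at hs1 ht1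
    simp [canonicalDiag]
    rw [show s ^ 2 * t ^ 2 * ((starRingEnd ℂ) t ^ 2 * (starRingEnd ℂ) s ^ 2) =
      ((starRingEnd ℂ) s * s) ^ 2 * ((starRingEnd ℂ) t * t) ^ 2 by ring, hs1, ht1]
    norm_num
  have hDT : Dᴴᵀ = Dᴴ := by simp [D, diagonal_conjTranspose]
  have hOT : Oᴴ = Oᵀ := by
    rw [← Matrix.one_mul Oᴴ, ← mul_eq_one_comm.1 hO', Matrix.mul_assoc, hO, Matrix.mul_one]
  -- This factor is forced by `U = O * D * R`. It is orthogonal because `U * Uᵀ = O * D ^ 2 * Oᵀ`.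
  let R := Dᴴ * Oᵀ * U
  refine ⟨magic * O * magicᴴ, magic * R * magicᴴ, isSpecialReal_magic_conj hO hO' hOdet,
    isSpecialReal_magic_conj ?_ ?_ ?_, s, t, hs1, ht1, ?_⟩
  · simp only [R, ← hOT, conjTranspose_mul, conjTranspose_conjTranspose]
    rw [show Dᴴ * Oᴴ * U * (Uᴴ * (O * D)) = Dᴴ * (Oᴴ * (U * Uᴴ) * O) * D by
      simp only [Matrix.mul_assoc], hU, Matrix.mul_one, mul_eq_one_comm.1 hO, Matrix.mul_one, hDu']
  · simp only [R, transpose_mul, transpose_transpose, hDT]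
    rw [show Dᴴ * Oᵀ * U * (Uᵀ * (O * Dᴴ)) = Dᴴ * Oᵀ * (U * Uᵀ) * O * Dᴴ by
      simp only [Matrix.mul_assoc], hS, ← hDD,
      show Dᴴ * Oᵀ * (O * (D * D) * Oᵀ) * O * Dᴴ = Dᴴ * (Oᵀ * O) * (D * D) * (Oᵀ * O) * Dᴴ by
        simp only [Matrix.mul_assoc], mul_eq_one_comm.1 hO', Matrix.mul_one, Matrix.mul_one,
      ← Matrix.mul_assoc, hDu', Matrix.one_mul, hDu]
  · simp only [R, det_mul, det_conjTranspose, det_transpose, hDdet, hOdet, hUdet]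
    simp
  · change u = magic * O * magicᴴ * (magic * D * magicᴴ) * (magic * (Dᴴ * Oᵀ * U) * magicᴴ)
    rw [show magic * O * magicᴴ * (magic * D * magicᴴ) * (magic * (Dᴴ * Oᵀ * U) * magicᴴ) =
      magic * (O * (magicᴴ * magic) * D * (magicᴴ * magic) * Dᴴ * Oᵀ * U) * magicᴴ by
        simp only [Matrix.mul_assoc], hE', Matrix.mul_one, Matrix.mul_one,
      Matrix.mul_assoc O, hDu, Matrix.mul_one, hO', Matrix.one_mul, ← huU]

/-! ### Parity phases -/

/-- Multiplication by `p` on `span(|0⟩, |3⟩)` and by the conjugate of `p` on `span(|1⟩, |2⟩)`. -/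
noncomputable def parityPhase (p : ℂ) : Matrix Idx Idx ℂ :=
  diagonal fun i => if i.1 = i.2 then p else star p

theorem parityPhase_unitary {p : ℂ} (hp : star p * p = 1) :
    parityPhase p * (parityPhase p)ᴴ = 1 := by
  simp only [parityPhase, diagonal_conjTranspose, diagonal_mul_diagonal]
  rw [← diagonal_one]
  congr 1
  funext i
  simp only [Pi.star_apply]
  split_ifs
  · rw [mul_comm, hp]
  · rw [star_star, hp]

theorem parityPhase_det {p : ℂ} (hp : star p * p = 1) : (parityPhase p).det = 1 := by
  rw [parityPhase, det_diagonal, Fintype.prod_prod_type]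
  simp only [Fin.prod_univ_two]
  simp
  simp only [Complex.star_def] at hp
  linear_combination ((starRingEnd ℂ) p * p + 1) * hp

theorem exists_phase_mul_real (w : ℂ) : ∃ q : ℂ, star q * q = 1 ∧ star (q * w) = q * w := by
  by_cases hw : w = 0
  · exact ⟨1, by simp, by simp [hw]⟩
  · have hn : (‖w‖ : ℂ) ≠ 0 := by simpa using hw
    refine ⟨star w / ‖w‖, ?_, ?_⟩
    · simp only [Complex.star_def, map_div₀, Complex.conj_conj, Complex.conj_ofReal]
      field_simp
      rw [Complex.mul_conj']
    · simp only [Complex.star_def, map_div₀, map_mul, Complex.conj_conj, Complex.conj_ofReal]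
      ring

/-- The trace has the form `q * A - star q * B` with `q = p ^ 2`. Since `-z` and `star z` have the
same imaginary part, it is real exactly when `q * (A + star B)` is, and a phase `q` achieves this.
-/
theorem exists_parityPhase_trace_real (G : Matrix Idx Idx ℂ) :
    ∃ p : ℂ, star p * p = 1 ∧
      star (parityPhase p * G * parityPhase p * pairing).trace =
        (parityPhase p * G * parityPhase p * pairing).trace := by
  obtain ⟨q, hq, hqw⟩ := exists_phase_mul_real
    ((G (0, 0) (1, 1) + G (1, 1) (0, 0)) + star (G (0, 1) (1, 0) + G (1, 0) (0, 1)))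
  obtain ⟨p, rfl, hp⟩ := exists_unit_sqrt hq
  refine ⟨p, hp, ?_⟩
  have : (parityPhase p * G * parityPhase p * pairing).trace =
      p ^ 2 * (G (0, 0) (1, 1) + G (1, 1) (0, 0)) -
        star p ^ 2 * (G (0, 1) (1, 0) + G (1, 0) (0, 1)) := by
    simp [trace, mul_apply, Fintype.sum_prod_type, parityPhase, pairing, diagonal_apply]
    ring
  rw [this]
  simp only [Complex.star_def, map_mul, map_sub, map_add, map_pow, Complex.conj_conj] at hqw ⊢
  linear_combination hqw

theorem parityPhase_apply_even (p : ℂ) {x : StateSpace}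
    (hx : x ∈ Submodule.span ℂ {ket 0, ket 3}) : toEuclideanLin (parityPhase p) x = p • x := by
  obtain ⟨a, b, rfl⟩ := Submodule.mem_span_pair.1 hx
  ext ⟨i, j⟩
  fin_cases i <;> fin_cases j <;>
    simp [ket, parityPhase, toLpLin_apply, mulVec_diagonal]

theorem parityPhase_apply_odd (p : ℂ) {x : StateSpace}
    (hx : x ∈ Submodule.span ℂ {ket 1, ket 2}) :
    toEuclideanLin (parityPhase p) x = star p • x := by
  obtain ⟨a, b, rfl⟩ := Submodule.mem_span_pair.1 hx
  ext ⟨i, j⟩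
  fin_cases i <;> fin_cases j <;>
    simp [ket, parityPhase, toLpLin_apply, mulVec_diagonal]

theorem preservedBy_parityPhase (p : ℂ) {b : OrthonormalBasis (Fin 4) ℂ StateSpace}
    (hb : IsParityBasis b) {n : ℕ} {M : Measurement n} (hM : M.IsIn b) :
    M.PreservedBy (parityPhase p) := by
  intro i x hx
  obtain ⟨s, hs⟩ := hM i
  rw [hs] at hx ⊢
  induction hx using Submodule.span_induction with
  | mem y hy =>
    obtain ⟨k, hk, rfl⟩ := hy
    have hmem := Submodule.subset_span (R := ℂ) (Set.mem_image_of_mem b hk)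
    rcases hb k with h | h
    · rw [parityPhase_apply_even p h]
      exact Submodule.smul_mem _ _ hmem
    · rw [parityPhase_apply_odd p h]
      exact Submodule.smul_mem _ _ hmem
  | zero => simp
  | add y z _ _ hy hz => rw [map_add]; exact Submodule.add_mem _ hy hz
  | smul c y _ hy => rw [map_smul]; exact Submodule.smul_mem _ _ hy

/-! ### Assembling the circuit -/

theorem exists_two_cnot_mul_parityPhase (u : Matrix.unitaryGroup Idx ℂ) :
    ∃ p z : ℂ, star p * p = 1 ∧ ‖z‖ = 1 ∧
      ∃ a b g h c d : Matrix.unitaryGroup (Fin 2) ℂ,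
        z • (parityPhase p * (u : Matrix Idx Idx ℂ)) =
          ((c : Matrix (Fin 2) (Fin 2) ℂ) ⊗ₖ (d : Matrix (Fin 2) (Fin 2) ℂ)) *
          (cnotMatrix 0 * ((g : Matrix (Fin 2) (Fin 2) ℂ) ⊗ₖ (h : Matrix (Fin 2) (Fin 2) ℂ)) *
            cnotMatrix 0) *
          ((a : Matrix (Fin 2) (Fin 2) ℂ) ⊗ₖ (b : Matrix (Fin 2) (Fin 2) ℂ)) := by
  have hu : (u : Matrix Idx Idx ℂ) * (u : Matrix Idx Idx ℂ)ᴴ = 1 := mem_unitaryGroup_iff.1 u.2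
  generalize (u : Matrix Idx Idx ℂ) = u at hu
  have hdet : star u.det * u.det = 1 := by
    have := congrArg det hu
    rw [det_mul, det_conjTranspose, det_one] at this
    rw [mul_comm, this]
  -- Dividing by a fourth root `y` of the determinant brings `u` to determinant one; `star y`
  -- becomes the global phase.
  obtain ⟨x, hx, hx1⟩ := exists_unit_sqrt hdet
  obtain ⟨y, rfl, hy1⟩ := exists_unit_sqrt hx1
  let G := star y • u
  have hG : G * Gᴴ = 1 := by
    simp only [G, conjTranspose_smul, star_star, Matrix.smul_mul,
      Matrix.mul_smul, smul_smul, hu, mul_comm y, hy1, one_smul]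
  have hGdet : G.det = 1 := by
    simp only [G, det_smul, ← hx]
    rw [show Fintype.card Idx = 4 from rfl, show star y ^ 4 * (y ^ 2) ^ 2 = (star y * y) ^ 4 by ring,
      hy1, one_pow]
  obtain ⟨p, hp, htr⟩ := exists_parityPhase_trace_real (G * pairing * Gᵀ)
  have hpT : (parityPhase p)ᵀ = parityPhase p := diagonal_transpose _
  obtain ⟨k, l, hk, hl, s, t, hs, ht, hkl⟩ := exists_two_cnot_decomposition
    (u := parityPhase p * G)
    (by rw [conjTranspose_mul, show parityPhase p * G * (Gᴴ * (parityPhase p)ᴴ) =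
      parityPhase p * (G * Gᴴ) * (parityPhase p)ᴴ by simp only [Matrix.mul_assoc], hG,
      Matrix.mul_one, parityPhase_unitary hp])
    (by rw [det_mul, parityPhase_det hp, hGdet, one_mul])
    (by simpa only [transpose_mul, hpT, Matrix.mul_assoc] using htr)
  obtain ⟨c, d, hc, hd, rfl⟩ := hk.exists_kronecker
  obtain ⟨a, b, ha, hb, rfl⟩ := hl.exists_kronecker
  obtain ⟨g, h, hg, hh, hgh⟩ := canonical_eq_two_cnot hs ht
  refine ⟨p, star y, hp, ?_, ⟨a, mem_unitaryGroup_iff.2 ha⟩, ⟨b, mem_unitaryGroup_iff.2 hb⟩,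
    ⟨g, mem_unitaryGroup_iff.2 hg⟩, ⟨h, mem_unitaryGroup_iff.2 hh⟩,
    ⟨c, mem_unitaryGroup_iff.2 hc⟩, ⟨d, mem_unitaryGroup_iff.2 hd⟩, ?_⟩
  · rw [Complex.star_def, Complex.conj_mul'] at hy1
    norm_cast at hy1
    rw [norm_star]
    exact (pow_eq_one_iff_of_nonneg (norm_nonneg _) two_ne_zero).1 hy1
  · rw [← hgh, ← hkl, Matrix.mul_smul]

end TwoQubit

theorem mainTheorem10 :
    ∃ S : TwoQubit.GenericCircuit, S.cnotCount = 2 ∧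
      ∀ u : Matrix.unitaryGroup TwoQubit.Idx ℂ,
        ∃ C : TwoQubit.Circuit, TwoQubit.IsInstance C S ∧
          ∀ b : OrthonormalBasis (Fin 4) ℂ TwoQubit.StateSpace, TwoQubit.IsParityBasis b →
            ∀ (n : ℕ) (M : TwoQubit.Measurement n), M.IsIn b →
              TwoQubit.SimulatesUpTo C u M := by
  refine ⟨[.placeholder 0 Set.univ, .placeholder 1 Set.univ, .constant (.cnot 0),
    .placeholder 0 Set.univ, .placeholder 1 Set.univ, .constant (.cnot 0),
    .placeholder 0 Set.univ, .placeholder 1 Set.univ], rfl, fun u => ?_⟩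
  obtain ⟨p, z, hp, hz, a, b, g, h, c, d, heq⟩ := TwoQubit.exists_two_cnot_mul_parityPhase u
  refine ⟨[.oneQubit 0 a, .oneQubit 1 b, .cnot 0, .oneQubit 0 g, .oneQubit 1 h, .cnot 0,
    .oneQubit 0 c, .oneQubit 1 d], ?_, fun B hB n M hM => ?_⟩
  · simp [TwoQubit.IsInstance, TwoQubit.Slot.gates]
  · refine ⟨⟨TwoQubit.parityPhase p,
      Matrix.mem_unitaryGroup_iff.2 (TwoQubit.parityPhase_unitary hp)⟩,
      TwoQubit.preservedBy_parityPhase p hB hM, z, hz, ?_⟩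
    rw [heq]
    -- Each layer puts its gate on qubit 0 first, hence on the right of the product.
    have hk : ∀ A B : Matrix (Fin 2) (Fin 2) ℂ,
        Matrix.kroneckerMap (· * ·) 1 B * Matrix.kroneckerMap (· * ·) A 1 =
          Matrix.kroneckerMap (· * ·) A B := by
      intro A B
      rw [← Matrix.mul_kronecker_mul, Matrix.one_mul, Matrix.mul_one]
    rw [← hk a b, ← hk g h, ← hk c d]
    simp [TwoQubit.Circuit.matrix, TwoQubit.Gate.matrix, Matrix.mul_assoc, Matrix.kronecker]
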